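/- Let $\mathcal X$ be a finite alphabet, $P$ a pmf on $\mathcal X$, and $X_1,X_2,\dots$ i.i.d. with law $P$. A binary prefix-free code is a map $e:\mathcal X\to\{0,1\}^*$ with nonempty codewords such that $e(x)$ is not a prefix of $e(y)$ for $x\ne y$; let $\ell(x)$ be the length of $e(x)$. In the memoryless update scheme with code $e$, the encoder picks up the symbol $X_{\tau_0}$ at time $\tau_0=1$; the symbol $X_{\tau_k}$ picked up at time $\tau_k$ is sent at one bit per unit time and is completely received at time $\tau_{k+1}=\tau_k+\ell(X_{\tau_k})$, at which time the encoder picks up the next symbol $X_{\tau_{k+1}}$ (symbols observed in between are skipped). Let $U(t)=\max\{\tau_k:\tau_{k+1}\le t\}$ (and $U(t)=0$ if there is no such $k$) be the time index of the most recent symbol received by time $t$, and let the average age of $e$ be $$\bar A(e)=\limsup_{T\to\infty}\frac1T\sum_{t=1}^T\bigl(t-U(t)\bigr).$$ Then for every prefix-free code $e$ the random variable $\bar A(e)$ is almost surely equal to a finite constant, the minimum $\bar A^*$ of these constants over all prefix-free codes $e$ exists, and $$\frac32 H(P)-\frac12\;\le\;\bar A^*\;\le\;\frac32\log_2|\mathcal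 X|+1,$$ where $H(P)=-\sum_{x\in\mathcal X}P(x)\log_2P(x)$ (with $0\log_2 0=0$). -/

import Mathlib

open MeasureTheory ProbabilityTheory Filter

/-- A binary prefix-free code on the alphabet `𝒳`: distinct symbols get codewords none of which
is a prefix of another. Codewords are nonempty (so every transmission takes at least one time
unit); for an alphabet with at least two symbols this follows from prefix-freeness. -/
structure PrefixFreeCode (𝒳 : Type*) where
  /-- the encoder -/
  encode : 𝒳 → List Bool
  encode_ne_nil : ∀ x, encode x ≠ []
  prefix_free : ∀ x y, encode x <+: encode y → x = y

namespace PrefixFreeCode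

variable {𝒳 : Type*}

/-- The codeword length `ℓ(x)`: the number of time units that the transmission of `x` takes. -/
def len (e : PrefixFreeCode 𝒳) (x : 𝒳) : ℕ := (e.encode x).length

/-- The time at which the encoder picks up its `k`-th symbol (`k = 0, 1, …`) when the symbol
observed at time `t` is `x t`, `t ≥ 1`. The first symbol is picked up at time `1`; a symbol picked
up at time `t` occupies the channel during the slots `t, …, t + ℓ(x t) - 1`, it is available at the
receiver at time `t + ℓ(x t)`, and at that time the encoder picks up the next symbol. -/
def pickup (e : PrefixFreeCode 𝒳) (x : ℕ → 𝒳) : ℕ → ℕ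
  | 0 => 1
  | k + 1 => e.pickup x k + e.len (x (e.pickup x k))

/-- The time index `U(t)` declared by the decoder at time `t`: the pick-up time of the latest
symbol all of whose bits have been received by time `t` (and `0` if there is none yet). The
`k`-th symbol has been completely received at the time when the next one is picked up. -/
noncomputable def decodedIndex (e : PrefixFreeCode 𝒳) (x : ℕ → 𝒳) (t : ℕ) : ℕ :=
  sSup {s : ℕ | ∃ k : ℕ, e.pickup x k = s ∧ e.pickup x (k + 1) ≤ t}

/-- The age `A(t) = t - U(t)` of the symbol available at the receiver at time `t`. -/
noncomputable def age (e : PrefixFreeCode 𝒳) (x : ℕ → 𝒳) (t : ℕ) : ℝ :=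
  (t : ℝ) - (e.decodedIndex x t : ℝ)

/-- The average age `limsup_{T → ∞} (1/T) ∑_{t=1}^T A(t)` along the symbol sequence `x`. -/
noncomputable def averageAge (e : PrefixFreeCode 𝒳) (x : ℕ → 𝒳) : EReal :=
  limsup (fun T : ℕ => (((1 / (T : ℝ)) * ∑ t ∈ Finset.Icc 1 T, e.age x t : ℝ) : EReal)) atTop

end PrefixFreeCode

/-- The Shannon entropy (in bits) of a pmf on a finite alphabet, with `0 log 0 = 0`. -/
noncomputable def entropyBits {𝒳 : Type*} [Fintype 𝒳] (P : PMF 𝒳) : ℝ :=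
  -∑ x, (P x).toReal * Real.logb 2 (P x).toReal

/-! Each transmission of length `L_{k+1}` runs while the receiver holds a symbol of age `L_k` and
growing, so it contributes `L_k L_{k+1} + L_{k+1} (L_{k+1} - 1) / 2` to the total age (`sum_age`).
The picked symbols are again i.i.d. with law `P`, because a pick-up time depends only on earlier
symbols (`map_picked_fin`, `iIndepFun_picked`). The strong law then gives the almost sure value `E L
+ E L² / (2 E L) - 1/2` (`meanAge`).

As `E L² ≥ (E L)²`, this is at least `(3/2) E L - 1/2`, and Kraft's inequality gives `E L ≥ H(P)`. A
fixed-length code has equality in the former bound, which yields the upper bound. The minimum is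
attained because only finitely many values of `meanAge` lie below any given bound. -/

namespace PrefixFreeCode

variable {𝒳 : Type*}

/-! ### Pick-up times and accumulated age along a fixed symbol sequence. -/

lemma len_pos (e : PrefixFreeCode 𝒳) (x : 𝒳) : 0 < e.len x :=
  List.length_pos_iff.2 (e.encode_ne_nil x)

/-- The `k`-th symbol picked up by the encoder. -/
def picked (e : PrefixFreeCode 𝒳) (x : ℕ → 𝒳) (k : ℕ) : 𝒳 := x (e.pickup x k)

lemma pickup_succ (e : PrefixFreeCode 𝒳) (x : ℕ → 𝒳) (k : ℕ) :
    e.pickup x (k + 1) = e.pickup x k + e.len (e.picked x k) := rfl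

lemma pickup_eq (e : PrefixFreeCode 𝒳) (x : ℕ → 𝒳) (k : ℕ) :
    e.pickup x k = 1 + ∑ i ∈ Finset.range k, e.len (e.picked x i) := by
  induction k with
  | zero => rfl
  | succ k ih => rw [pickup_succ, Finset.sum_range_succ, ih, add_assoc]

lemma pickup_strictMono (e : PrefixFreeCode 𝒳) (x : ℕ → 𝒳) : StrictMono (e.pickup x) :=
  strictMono_nat_of_lt_succ fun k => by
    rw [pickup_succ]
    exact Nat.lt_add_of_pos_right (e.len_pos _)

lemma one_le_pickup (e : PrefixFreeCode 𝒳) (x : ℕ → 𝒳) (k : ℕ) : 1 ≤ e.pickup x k := by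
  rw [pickup_eq]; exact Nat.le_add_right _ _

/-- The scheme only looks at the symbols observed at times `t ≥ 1`. -/
lemma pickup_congr (e : PrefixFreeCode 𝒳) {x y : ℕ → 𝒳} (h : ∀ t, 1 ≤ t → x t = y t) :
    e.pickup x = e.pickup y := by
  funext k
  induction k with
  | zero => rfl
  | succ k ih =>
    rw [pickup_succ, pickup_succ, picked, picked, h _ (e.one_le_pickup x k), ih]

lemma averageAge_congr (e : PrefixFreeCode 𝒳) {x y : ℕ → 𝒳} (h : ∀ t, 1 ≤ t → x t = y t) :
    e.averageAge x = e.averageAge y := by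
  simp only [averageAge, age, decodedIndex, e.pickup_congr h]

lemma decodedIndex_le (e : PrefixFreeCode 𝒳) (x : ℕ → 𝒳) (t : ℕ) : e.decodedIndex x t ≤ t := by
  refine csSup_le' ?_
  rintro s ⟨k, rfl, hk⟩
  exact ((e.pickup_strictMono x).monotone k.le_succ).trans hk

lemma age_nonneg (e : PrefixFreeCode 𝒳) (x : ℕ → 𝒳) (t : ℕ) : 0 ≤ e.age x t :=
  sub_nonneg.2 (Nat.cast_le.2 (e.decodedIndex_le x t))

lemma decodedIndex_eq_zero (e : PrefixFreeCode 𝒳) (x : ℕ → 𝒳) {t : ℕ} (ht : t < e.pickup x 1) :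
    e.decodedIndex x t = 0 := by
  have : {s : ℕ | ∃ k : ℕ, e.pickup x k = s ∧ e.pickup x (k + 1) ≤ t} = ∅ := by
    refine Set.eq_empty_of_forall_notMem ?_
    rintro s ⟨k, -, hk⟩
    exact absurd (ht.trans_le ((e.pickup_strictMono x).monotone (Nat.le_add_left 1 k)))
      (not_lt.2 hk)
  rw [decodedIndex, this, csSup_empty, bot_eq_zero]

lemma decodedIndex_eq_pickup (e : PrefixFreeCode 𝒳) (x : ℕ → 𝒳) {t k : ℕ}
    (h : e.pickup x (k + 1) ≤ t) (h' : t < e.pickup x (k + 2)) :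
    e.decodedIndex x t = e.pickup x k := by
  refine IsGreatest.csSup_eq ⟨⟨k, rfl, h⟩, ?_⟩
  rintro s ⟨j, rfl, hj⟩
  have := (e.pickup_strictMono x).lt_iff_lt.1 (hj.trans_lt h')
  exact (e.pickup_strictMono x).monotone (by omega)

end PrefixFreeCode

lemma sum_Ioc_sub (a n : ℕ) (d : ℝ) :
    ∑ t ∈ Finset.Ioc a (a + n), ((t : ℝ) - d) = n * (a - d) + n * (n + 1) / 2 := by
  induction n with
  | zero => simp
  | succ n ih =>
    rw [← add_assoc, Finset.sum_Ioc_succ_top (by omega), ih]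
    push_cast
    ring

namespace PrefixFreeCode

variable {𝒳 : Type*}

/-- The total age accumulated until just before the `(k + 1)`-st pick-up. -/
lemma sum_age (e : PrefixFreeCode 𝒳) (x : ℕ → 𝒳) (k : ℕ) :
    ∑ t ∈ Finset.Ioc 0 (∑ i ∈ Finset.range (k + 1), e.len (e.picked x i)), e.age x t =
      (e.len (e.picked x 0) : ℝ) * (e.len (e.picked x 0) + 1) / 2 +
      ∑ i ∈ Finset.range k, ((e.len (e.picked x i) : ℝ) * e.len (e.picked x (i + 1)) +
        (e.len (e.picked x (i + 1)) : ℝ) * (e.len (e.picked x (i + 1)) - 1) / 2) := by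
  induction k with
  | zero =>
    have := sum_Ioc_sub 0 (e.len (e.picked x 0)) 0
    simp only [sub_zero, zero_add, Nat.cast_zero, mul_zero] at this
    simp only [zero_add, Finset.sum_range_one, Finset.sum_range_zero, add_zero]
    rw [← this]
    refine Finset.sum_congr rfl fun t ht => ?_
    have h1 : e.pickup x 1 = 1 + e.len (e.picked x 0) := by simp [pickup_eq]
    rw [Finset.mem_Ioc] at ht
    rw [age, e.decodedIndex_eq_zero x (by omega), Nat.cast_zero, sub_zero]
  | succ k ih =>
    rw [Finset.sum_range_succ _ (k + 1),
      ← Finset.sum_Ioc_consecutive _ (Nat.zero_le _) (Nat.le_add_right _ _), ih]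
    conv_rhs => rw [Finset.sum_range_succ, ← add_assoc]
    congr 1
    have h0 := e.pickup_eq x k
    have h1 := e.pickup_eq x (k + 1)
    have h2 := e.pickup_succ x (k + 1)
    have hr := Finset.sum_range_succ (fun i => e.len (e.picked x i)) k
    -- Pick-ups start at time 1, so this interval is exactly the slots from pick-up `k + 1` until
    -- just before pick-up `k + 2`; symbol `k` is the latest one received there.
    have hcongr : ∀ t ∈ Finset.Ioc (∑ i ∈ Finset.range (k + 1), e.len (e.picked x i))
        (∑ i ∈ Finset.range (k + 1), e.len (e.picked x i) + e.len (e.picked x (k + 1))),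
        e.age x t = (t : ℝ) - (e.pickup x k : ℝ) := by
      intro t ht
      rw [Finset.mem_Ioc] at ht
      rw [age, e.decodedIndex_eq_pickup x (k := k) (by omega) (by rw [h2]; omega)]
    rw [Finset.sum_congr rfl hcongr, sum_Ioc_sub, h0, hr]
    push_cast
    ring

/-- Convergence of the time average of the age, given convergence of the averages of the lengths
and of the ages per symbol along even numbers of transmissions. -/
lemma averageAge_eq_of_tendsto (e : PrefixFreeCode 𝒳) (x : ℕ → 𝒳) {m c : ℝ} (hm : 0 < m)
    (h1 : Tendsto (fun n : ℕ => (∑ i ∈ Finset.range (2 * n + 1), (e.len (e.picked x i) : ℝ)) / n)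
      atTop (nhds m))
    (h2 : Tendsto (fun n : ℕ => (∑ i ∈ Finset.range (2 * n),
        ((e.len (e.picked x i) : ℝ) * e.len (e.picked x (i + 1)) +
        (e.len (e.picked x (i + 1)) : ℝ) * (e.len (e.picked x (i + 1)) - 1) / 2)) / n)
      atTop (nhds c)) :
    e.averageAge x = ((c / m : ℝ) : EReal) := by
  set S : ℕ → ℝ := fun T => ∑ t ∈ Finset.Ioc 0 T, e.age x t with hS
  set σ : ℕ → ℕ := fun n => ∑ i ∈ Finset.range (2 * n + 1), e.len (e.picked x i) with hσ
  have hσr : ∀ n, (σ n : ℝ) = ∑ i ∈ Finset.range (2 * n + 1), (e.len (e.picked x i) : ℝ) :=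
    fun n => by simp [hσ]
  have hσ1 : Tendsto (fun n : ℕ => (σ n : ℝ) / n) atTop (nhds m) := by simpa only [hσr] using h1
  have hSσ : Tendsto (fun n : ℕ => S (σ n) / n) atTop (nhds c) := by
    have h3 := (tendsto_const_div_atTop_nhds_zero_nat
      ((e.len (e.picked x 0) : ℝ) * (e.len (e.picked x 0) + 1) / 2)).add h2
    rw [zero_add] at h3
    refine h3.congr fun n => ?_
    rw [← add_div]
    simp only [hS, hσ]
    rw [e.sum_age x (2 * n)]
  have hmono : Monotone S := fun a b hab =>
    Finset.sum_le_sum_of_subset_of_nonneg (Finset.Ioc_subset_Ioc_right hab)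
      fun t _ _ => e.age_nonneg x t
  have hpos : ∀ n, 0 < σ n := fun n =>
    Finset.sum_pos (fun i _ => e.len_pos _) (by simp)
  have htop : Tendsto σ atTop atTop := by
    refine tendsto_atTop_mono (fun n => ?_) tendsto_id
    calc n ≤ ∑ i ∈ Finset.range (2 * n + 1), 1 := by simp; omega
      _ ≤ σ n := Finset.sum_le_sum fun i _ => e.len_pos _
  have hratio : Tendsto (fun n : ℕ => (σ (n + 1) : ℝ) / σ n) atTop (nhds 1) := by
    have tendsto_add_one_div : Tendsto (fun n : ℕ => ((n : ℝ) + 1) / n) atTop (nhds 1) := by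
      simpa using (tendsto_natCast_div_add_atTop (1 : ℝ)).inv₀ one_ne_zero
    have h4 := (hσ1.comp (tendsto_add_atTop_nat 1)).div hσ1 hm.ne'
    have h5 := h4.mul tendsto_add_one_div
    rw [div_self hm.ne', one_mul] at h5
    refine h5.congr' ?_
    filter_upwards [eventually_gt_atTop 0] with n hn
    have := hpos n
    simp only [Function.comp, Pi.div_apply]
    push_cast
    field_simp
  -- The partial sums are monotone and consecutive values of `σ` have ratio tending to 1, so
  -- convergence along `σ` forces convergence along all times.
  have key : Tendsto (fun T : ℕ => S T / T) atTop (nhds (c / m)) := by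
    refine tendsto_div_of_monotone_of_exists_subseq_tendsto_div S _ hmono fun a ha =>
      ⟨σ, ?_, htop, ?_⟩
    · filter_upwards [hratio.eventually_lt_const ha] with n hn
      have : (0 : ℝ) < σ n := by exact_mod_cast hpos n
      rw [div_lt_iff₀ this] at hn
      exact hn.le
    · refine (hSσ.div hσ1 hm.ne').congr' ?_
      filter_upwards [eventually_gt_atTop 0] with n hn
      have := hpos n
      simp only [Pi.div_apply]
      field_simp
  refine Tendsto.limsup_eq ?_
  refine (continuous_coe_real_ereal.tendsto _).comp (key.congr fun T => ?_)
  rw [div_eq_inv_mul, one_div]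
  rfl

end PrefixFreeCode

/-! ### The picked symbols are i.i.d. -/

namespace PrefixFreeCode

variable {𝒳 : Type*}

/-- Prescribing the picked symbols makes the random pick-up times deterministic and distinct, so the
event concerns the symbols at fixed times and independence applies. -/
lemma picked_eq_iff (e : PrefixFreeCode 𝒳) (x y : ℕ → 𝒳) (n : ℕ) :
    (∀ i < n, e.picked x i = y i) ↔
      ∀ i < n, x (1 + ∑ j ∈ Finset.range i, e.len (y j)) = y i := by
  induction n with
  | zero => simp
  | succ n ih =>
    simp only [Nat.lt_succ_iff_lt_or_eq, or_imp, forall_and, forall_eq]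
    rw [← ih]
    refine and_congr_right fun h => ?_
    rw [picked, pickup_eq, Finset.sum_congr rfl fun j hj => by rw [h j (Finset.mem_range.1 hj)]]

lemma strictMono_one_add_sum_len (e : PrefixFreeCode 𝒳) (y : ℕ → 𝒳) :
    StrictMono fun i => 1 + ∑ j ∈ Finset.range i, e.len (y j) :=
  strictMono_nat_of_lt_succ fun k => by
    rw [Finset.sum_range_succ]
    have := e.len_pos (y k)
    omega

section Probability

variable [MeasurableSpace 𝒳] {Ω : Type*} [MeasurableSpace Ω]

lemma measurable_picked_of_pickup (e : PrefixFreeCode 𝒳) {X : ℕ → Ω → 𝒳}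
    (hX : ∀ t, Measurable (X t)) {k : ℕ} (h : Measurable fun ω => e.pickup (fun t => X t ω) k) :
    Measurable fun ω => e.picked (fun t => X t ω) k :=
  (measurable_from_prod_countable_right (f := fun p : ℕ × Ω => X p.1 p.2) hX).comp
    (h.prodMk measurable_id)

variable [DiscreteMeasurableSpace 𝒳]

lemma measurable_pickup (e : PrefixFreeCode 𝒳) {X : ℕ → Ω → 𝒳} (hX : ∀ t, Measurable (X t))
    (k : ℕ) : Measurable fun ω => e.pickup (fun t => X t ω) k := by
  induction k with
  | zero => exact measurable_const
  | succ k ih =>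
    exact ih.add ((Measurable.of_discrete (f := e.len)).comp (e.measurable_picked_of_pickup hX ih))

lemma measurable_picked (e : PrefixFreeCode 𝒳) {X : ℕ → Ω → 𝒳} (hX : ∀ t, Measurable (X t))
    (k : ℕ) : Measurable fun ω => e.picked (fun t => X t ω) k :=
  e.measurable_picked_of_pickup hX (e.measurable_pickup hX k)

lemma measurable_picked_fin (e : PrefixFreeCode 𝒳) {X : ℕ → Ω → 𝒳} (hX : ∀ t, Measurable (X t))
    (n : ℕ) : Measurable fun ω (i : Fin n) => e.picked (fun t => X t ω) i :=
  measurable_pi_lambda _ fun i => e.measurable_picked hX i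

variable {μ : Measure Ω} {P : PMF 𝒳} {X : ℕ → Ω → 𝒳}

lemma measure_picked_eq (e : PrefixFreeCode 𝒳) (hX : ∀ t, Measurable (X t))
    (hlaw : ∀ t, 1 ≤ t → μ.map (X t) = P.toMeasure)
    (hindep : iIndepFun (fun t : ℕ => X (t + 1)) μ) (y : ℕ → 𝒳) (n : ℕ) :
    μ {ω | ∀ i < n, e.picked (fun t => X t ω) i = y i} = ∏ i ∈ Finset.range n, P (y i) := by
  have hmono : StrictMono fun i => ∑ j ∈ Finset.range i, e.len (y j) := fun a b hab =>
    Nat.lt_of_add_lt_add_left (e.strictMono_one_add_sum_len y hab)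
  have hY := hindep.precomp hmono.injective
  have := (iIndepFun_iff_measure_inter_preimage_eq_mul.1 hY) (Finset.range n)
    (sets := fun i => {y i}) (fun i _ => measurableSet_singleton _)
  have hset : {ω | ∀ i < n, e.picked (fun t => X t ω) i = y i} =
      ⋂ i ∈ Finset.range n, (X (∑ j ∈ Finset.range i, e.len (y j) + 1)) ⁻¹' {y i} := by
    ext ω
    simp [picked_eq_iff, add_comm 1]
  rw [hset, this]
  refine Finset.prod_congr rfl fun i _ => ?_
  rw [← Measure.map_apply (hX _) (measurableSet_singleton _), hlaw _ (Nat.le_add_left _ _),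
    P.toMeasure_apply_singleton _ (measurableSet_singleton _)]

/-- The law of the first `n` picked symbols is the product law. -/
lemma map_picked_fin [Fintype 𝒳] (e : PrefixFreeCode 𝒳) (hX : ∀ t, Measurable (X t))
    (hlaw : ∀ t, 1 ≤ t → μ.map (X t) = P.toMeasure)
    (hindep : iIndepFun (fun t : ℕ => X (t + 1)) μ) (n : ℕ) :
    μ.map (fun ω (i : Fin n) => e.picked (fun t => X t ω) i) =
      Measure.pi fun _ : Fin n => P.toMeasure := by
  refine Measure.ext_of_singleton fun y => ?_
  rw [Measure.map_apply (e.measurable_picked_fin hX n)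
    (measurableSet_singleton _), Measure.pi_singleton]
  obtain ⟨z, hz⟩ : ∃ z : ℕ → 𝒳, ∀ i : Fin n, z i = y i :=
    ⟨fun i => if h : i < n then y ⟨i, h⟩ else P.support_nonempty.some, fun i => by simp⟩
  have := e.measure_picked_eq hX hlaw hindep z n
  rw [Finset.prod_range] at this
  simp only [hz] at this
  rw [Finset.prod_congr rfl fun i _ =>
    P.toMeasure_apply_singleton _ (measurableSet_singleton (y i)), ← this]
  congr 1
  ext ω
  simp only [Set.mem_preimage, Set.mem_singleton_iff, funext_iff, Set.mem_ofPred_eq]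
  exact ⟨fun h i hi => (h ⟨i, hi⟩).trans (hz ⟨i, hi⟩).symm, fun h i => (h i i.2).trans (hz i)⟩

lemma map_picked [Fintype 𝒳] (e : PrefixFreeCode 𝒳) (hX : ∀ t, Measurable (X t))
    (hlaw : ∀ t, 1 ≤ t → μ.map (X t) = P.toMeasure)
    (hindep : iIndepFun (fun t : ℕ => X (t + 1)) μ) (k : ℕ) :
    μ.map (fun ω => e.picked (fun t => X t ω) k) = P.toMeasure := by
  have h := e.map_picked_fin hX hlaw hindep (k + 1)
  have h' := congrArg (Measure.map (Function.eval (Fin.last k))) h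
  rw [Measure.map_map (measurable_pi_apply _)
    (e.measurable_picked_fin hX _), Measure.pi_map_eval] at h'
  simpa [Function.comp_def] using h'

lemma iIndepFun_picked [Fintype 𝒳] [IsProbabilityMeasure μ] (e : PrefixFreeCode 𝒳)
    (hX : ∀ t, Measurable (X t))
    (hlaw : ∀ t, 1 ≤ t → μ.map (X t) = P.toMeasure)
    (hindep : iIndepFun (fun t : ℕ => X (t + 1)) μ) :
    iIndepFun (fun k ω => e.picked (fun t => X t ω) k) μ := by
  rw [iIndepFun_iff_finset]
  intro s
  have hfin : iIndepFun (fun (i : Fin (s.sup id + 1)) ω => e.picked (fun t => X t ω) i) μ := by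
    rw [iIndepFun_iff_map_fun_eq_pi_map fun i : Fin (s.sup id + 1) => (e.measurable_picked hX i).aemeasurable,
      e.map_picked_fin hX hlaw hindep]
    congr 1
    funext i
    rw [e.map_picked hX hlaw hindep]
  have hlt : ∀ i : s, (i : ℕ) < s.sup id + 1 := fun i =>
    Nat.lt_succ_of_le (Finset.le_sup (f := id) i.2)
  exact hfin.precomp (g := fun i : s => (⟨i, hlt i⟩ : Fin (s.sup id + 1)))
    fun i j hij => Subtype.ext (congrArg Fin.val hij)

end Probability

end PrefixFreeCode

/-! ### The almost sure value of the average age. -/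

/-- The strong law of large numbers for functions of i.i.d. symbols from a finite alphabet. -/
lemma ae_tendsto_sum_div {S Ω : Type*} [Fintype S] [MeasurableSpace S] [DiscreteMeasurableSpace S]
    [MeasurableSpace Ω] {μ : Measure Ω} [IsProbabilityMeasure μ] {ρ : Measure S}
    {Y : ℕ → Ω → S} (hY : ∀ k, Measurable (Y k)) (hlaw : ∀ k, μ.map (Y k) = ρ)
    (hindep : Pairwise fun i j => IndepFun (Y i) (Y j) μ) (f : S → ℝ) :
    ∀ᵐ ω ∂μ, Tendsto (fun n : ℕ => (∑ i ∈ Finset.range n, f (Y i ω)) / n) atTop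
      (nhds (∫ s, f s ∂ρ)) := by
  have hf : Measurable f := .of_discrete
  have : IsProbabilityMeasure ρ := hlaw 0 ▸ Measure.isProbabilityMeasure_map (hY 0).aemeasurable
  have hint : Integrable f (μ.map (Y 0)) := by rw [hlaw]; exact .of_finite
  have h := strong_law_ae_real (μ := μ) (fun i ω => f (Y i ω))
    ((integrable_map_measure hf.aestronglyMeasurable (hY 0).aemeasurable).1 hint)
    (fun i j hij => (hindep hij).comp hf hf)
    (fun i => IdentDistrib.comp ⟨(hY i).aemeasurable, (hY 0).aemeasurable, by
      rw [hlaw, hlaw]⟩ hf)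
  rwa [← hlaw 0, integral_map (hY 0).aemeasurable hf.aestronglyMeasurable]

lemma tendsto_sum_range_two_mul_add_one {f : ℕ → ℝ} {a : ℝ}
    (h : Tendsto (fun n : ℕ => (∑ i ∈ Finset.range n, f i) / n) atTop (nhds a)) :
    Tendsto (fun n : ℕ => (∑ i ∈ Finset.range (2 * n + 1), f i) / n) atTop (nhds (2 * a)) := by
  have h1 : Tendsto (fun n : ℕ => 2 * n + 1) atTop atTop :=
    tendsto_atTop_mono (fun n => by dsimp; omega) tendsto_id
  have h2 : Tendsto (fun n : ℕ => (2 : ℝ) + 1 / n) atTop (nhds 2) := by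
    simpa using tendsto_const_nhds.add (tendsto_one_div_atTop_nhds_zero_nat (𝕜 := ℝ))
  refine (h2.mul (h.comp h1)).congr' ?_
  filter_upwards [eventually_gt_atTop 0] with n hn
  simp only [Function.comp]
  push_cast
  field_simp

/-- Products of consecutive lengths overlap and are not independent; split by parity, each family
uses disjoint pairs and obeys the strong law. -/
lemma sum_range_two_mul_consecutive (l : ℕ → ℝ) (n : ℕ) :
    ∑ i ∈ Finset.range (2 * n), (l i * l (i + 1) + l (i + 1) * (l (i + 1) - 1) / 2) =
      ∑ j ∈ Finset.range n, l (2 * j) * l (2 * j + 1) +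
      ∑ j ∈ Finset.range n, l (2 * j + 1) * l (2 * j + 2) +
      (∑ i ∈ Finset.range (2 * n + 1), l i ^ 2 - ∑ i ∈ Finset.range (2 * n + 1), l i) / 2 -
      (l 0 ^ 2 - l 0) / 2 := by
  induction n with
  | zero => simp
  | succ n ih =>
    rw [show 2 * (n + 1) = 2 * n + 1 + 1 by ring]
    simp only [Finset.sum_range_succ] at ih ⊢
    rw [ih]
    ring

namespace PrefixFreeCode

variable {𝒳 : Type*} [MeasurableSpace 𝒳]

/-- The almost sure value of the average age: `𝔼 L + 𝔼 L² / (2 𝔼 L) - 1 / 2`. -/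
noncomputable def meanAge (e : PrefixFreeCode 𝒳) (P : PMF 𝒳) : ℝ :=
  (∫ x, (e.len x : ℝ) ∂P.toMeasure) +
    (∫ x, (e.len x : ℝ) ^ 2 ∂P.toMeasure) / (2 * ∫ x, (e.len x : ℝ) ∂P.toMeasure) - 1 / 2

variable [Fintype 𝒳] [DiscreteMeasurableSpace 𝒳]

lemma one_le_integral_len (e : PrefixFreeCode 𝒳) (P : PMF 𝒳) :
    1 ≤ ∫ x, (e.len x : ℝ) ∂P.toMeasure := by
  have : ∫ _, (1 : ℝ) ∂P.toMeasure ≤ ∫ x, (e.len x : ℝ) ∂P.toMeasure :=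
    integral_mono .of_finite .of_finite fun x => by
      exact Nat.one_le_cast.2 (e.len_pos x)
  simpa using this

variable {Ω : Type*} [MeasurableSpace Ω] {μ : Measure Ω} [IsProbabilityMeasure μ] {P : PMF 𝒳}

lemma ae_averageAge_eq_of_measurable (e : PrefixFreeCode 𝒳) {X : ℕ → Ω → 𝒳}
    (hX : ∀ t, Measurable (X t))
    (hlaw : ∀ t, 1 ≤ t → μ.map (X t) = P.toMeasure)
    (hindep : iIndepFun (fun t : ℕ => X (t + 1)) μ) :
    ∀ᵐ ω ∂μ, e.averageAge (fun t => X t ω) = (e.meanAge P : EReal) := by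
  have hmeas := e.measurable_picked hX
  have hmap := e.map_picked hX hlaw hindep
  have hind := e.iIndepFun_picked hX hlaw hindep
  have hpair : ∀ i j, i ≠ j → μ.map (fun ω => (e.picked (fun t => X t ω) i,
      e.picked (fun t => X t ω) j)) = P.toMeasure.prod P.toMeasure := fun i j hij => by
    rw [(indepFun_iff_map_prod_eq_prod_map_map (hmeas i).aemeasurable
      (hmeas j).aemeasurable).1 (hind.indepFun hij), hmap, hmap]
  have hprod : ∫ z : 𝒳 × 𝒳, (e.len z.1 : ℝ) * e.len z.2 ∂(P.toMeasure.prod P.toMeasure) =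
      (∫ x, (e.len x : ℝ) ∂P.toMeasure) * ∫ x, (e.len x : ℝ) ∂P.toMeasure :=
    integral_prod_mul (fun x => (e.len x : ℝ)) (fun x => (e.len x : ℝ))
  have hpairs : ∀ d, ∀ᵐ ω ∂μ, Tendsto (fun n : ℕ => (∑ j ∈ Finset.range n,
      (e.len (e.picked (fun t => X t ω) (2 * j + d)) : ℝ) *
        e.len (e.picked (fun t => X t ω) (2 * j + d + 1))) / n) atTop
      (nhds ((∫ x, (e.len x : ℝ) ∂P.toMeasure) * ∫ x, (e.len x : ℝ) ∂P.toMeasure)) := by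
    intro d
    rw [← hprod]
    refine ae_tendsto_sum_div (Y := fun j ω => (e.picked (fun t => X t ω) (2 * j + d),
      e.picked (fun t => X t ω) (2 * j + d + 1))) (fun j => (hmeas _).prodMk (hmeas _))
      (fun j => hpair _ _ (by omega)) (fun i j hij => ?_)
      (fun z : 𝒳 × 𝒳 => (e.len z.1 : ℝ) * e.len z.2)
    exact hind.indepFun_prodMk_prodMk hmeas _ _ _ _ (by omega) (by omega) (by omega) (by omega)
  filter_upwards [ae_tendsto_sum_div hmeas hmap (fun i j hij => hind.indepFun hij)
      (fun x => (e.len x : ℝ)), ae_tendsto_sum_div hmeas hmap (fun i j hij => hind.indepFun hij)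
      (fun x => (e.len x : ℝ) ^ 2), hpairs 0, hpairs 1] with ω h1 h2 h3 h4
  have hm := e.one_le_integral_len P
  rw [meanAge]
  set m := ∫ x, (e.len x : ℝ) ∂P.toMeasure
  set q := ∫ x, (e.len x : ℝ) ^ 2 ∂P.toMeasure
  have h1' := tendsto_sum_range_two_mul_add_one h1
  have h2' := tendsto_sum_range_two_mul_add_one h2
  set l : ℕ → ℝ := fun i => (e.len (e.picked (fun t => X t ω) i) : ℝ)
  have h5 := (((h3.add h4).add ((h2'.sub h1').div_const 2)).sub
    (tendsto_const_div_atTop_nhds_zero_nat ((l 0 ^ 2 - l 0) / 2)))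
  rw [e.averageAge_eq_of_tendsto _ (m := 2 * m)
    (c := m * m + m * m + (2 * q - 2 * m) / 2 - 0) (by linarith) h1' (h5.congr fun n => ?_)]
  · congr 1
    field_simp
    ring
  · rw [sum_range_two_mul_consecutive l n]
    simp only [l, add_zero]
    ring

/-- `HasLaw` gives only a.e. measurability, so measurable versions are substituted; `X 0` is never
observed and may be replaced freely. -/
lemma ae_averageAge_eq (e : PrefixFreeCode 𝒳) {X : ℕ → Ω → 𝒳}
    (hlaw : ∀ t, 1 ≤ t → HasLaw (X t) P.toMeasure μ)
    (hindep : iIndepFun (fun t : ℕ => X (t + 1)) μ) :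
    ∀ᵐ ω ∂μ, e.averageAge (fun t => X t ω) = (e.meanAge P : EReal) := by
  choose Z hZ hXZ using fun t : ℕ => (hlaw (t + 1) (Nat.le_add_left 1 t)).aemeasurable
  have key := e.ae_averageAge_eq_of_measurable (μ := μ) (P := P) (X := fun t => Z (t - 1))
    (fun t => hZ _)
    (fun t ht => by
      obtain ⟨t, rfl⟩ := Nat.exists_eq_add_of_le' ht
      rw [Nat.add_sub_cancel, ← Measure.map_congr (hXZ t), (hlaw _ ht).map_eq])
    (hindep.congr hXZ)
  filter_upwards [key, ae_all_iff.2 hXZ] with ω h1 h2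
  rw [← h1]
  refine e.averageAge_congr fun t ht => ?_
  obtain ⟨t, rfl⟩ := Nat.exists_eq_add_of_le' ht
  exact h2 t

end PrefixFreeCode

/-! ### Bounds on the mean age: Kraft's inequality, entropy, fixed-length codes. -/

lemma PMF.sum_toReal_eq_one {𝒳 : Type*} [Fintype 𝒳] (P : PMF 𝒳) : ∑ x, (P x).toReal = 1 := by
  rw [← ENNReal.toReal_sum fun x _ => P.apply_ne_top x,
    ← tsum_fintype (L := SummationFilter.unconditional 𝒳), P.tsum_coe, ENNReal.toReal_one]

namespace PrefixFreeCode

variable {𝒳 : Type*}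

lemma encode_injective (e : PrefixFreeCode 𝒳) : Function.Injective e.encode :=
  fun x y h => e.prefix_free x y (h ▸ List.prefix_rfl)

/-- The first codewords of two equal concatenations are prefixes of one string, hence comparable,
hence equal. -/
lemma uniquelyDecodable (e : PrefixFreeCode 𝒳) :
    InformationTheory.UniquelyDecodable (Set.range e.encode) := by
  intro L₁
  induction L₁ with
  | nil =>
    rintro (_ | ⟨w, L₂⟩) - h₂ h
    · rfl
    · obtain ⟨x, rfl⟩ := h₂ w (by simp)
      simp [e.encode_ne_nil x] at h
  | cons v L₁ ih =>
    rintro (_ | ⟨w, L₂⟩) h₁ h₂ h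
    · obtain ⟨x, rfl⟩ := h₁ v (by simp)
      simp [e.encode_ne_nil x] at h
    · obtain ⟨x, rfl⟩ := h₁ v (by simp)
      obtain ⟨y, rfl⟩ := h₂ w (by simp)
      rw [List.flatten_cons, List.flatten_cons] at h
      have hxy : x = y := by
        rcases List.prefix_or_prefix_of_prefix (List.prefix_append _ _)
          (h ▸ List.prefix_append (e.encode y) L₂.flatten) with h' | h'
        · exact e.prefix_free _ _ h'
        · exact (e.prefix_free _ _ h').symm
      subst hxy
      rw [ih L₂ (fun w hw => h₁ w (by simp [hw])) (fun w hw => h₂ w (by simp [hw]))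
        (List.append_cancel_left h)]

/-- Kraft's inequality. -/
lemma sum_two_pow_neg_len_le_one [Fintype 𝒳] (e : PrefixFreeCode 𝒳) :
    ∑ x, (1 / 2 : ℝ) ^ e.len x ≤ 1 := by
  have h := InformationTheory.kraft_mcmillan_inequality
    (S := Finset.univ.map ⟨e.encode, e.encode_injective⟩) (by simpa using e.uniquelyDecodable)
  simpa [len] using h

/-- The fixed-length code of length `n`. -/
noncomputable def fixedLength [Fintype 𝒳] (n : ℕ) (hn : 0 < n) (h : Fintype.card 𝒳 ≤ 2 ^ n) :
    PrefixFreeCode 𝒳 :=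
  let f : 𝒳 ↪ (Fin n → Bool) :=
    (Function.Embedding.nonempty_of_card_le (by simpa using h)).some
  { encode := fun x => List.ofFn (f x)
    encode_ne_nil := fun x h => hn.ne' (by simpa using congrArg List.length h)
    prefix_free := fun x y h => f.injective
      (List.ofFn_injective (h.eq_of_length (by simp))) }

lemma len_fixedLength [Fintype 𝒳] (n : ℕ) (hn : 0 < n) (h : Fintype.card 𝒳 ≤ 2 ^ n) (x : 𝒳) :
    (fixedLength n hn h).len x = n := by
  simp [len, fixedLength]

variable [Fintype 𝒳] [MeasurableSpace 𝒳]

lemma exists_meanAge_le (P : PMF 𝒳) :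
    ∃ e : PrefixFreeCode 𝒳, e.meanAge P ≤ 3 / 2 * Real.logb 2 (Fintype.card 𝒳) + 1 := by
  have : Nonempty 𝒳 := ⟨P.support_nonempty.some⟩
  set N := Fintype.card 𝒳 with hN
  have hN0 : 0 < N := Fintype.card_pos
  have hlog : 0 ≤ Real.logb 2 N := Real.logb_nonneg one_lt_two (by exact_mod_cast hN0)
  obtain ⟨n, hn, hle, hlt⟩ : ∃ n : ℕ, 0 < n ∧ N ≤ 2 ^ n ∧ (n : ℝ) ≤ Real.logb 2 N + 1 := by
    rcases Nat.eq_or_lt_of_le (Nat.succ_le_of_lt hN0) with h1 | h1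
    -- With one symbol `Nat.clog` would be 0, but codewords are nonempty.
    · exact ⟨1, one_pos, by omega, by simpa using hlog⟩
    · refine ⟨Nat.clog 2 N, Nat.clog_pos one_lt_two h1, Nat.le_pow_clog one_lt_two _, ?_⟩
      have h2 := Nat.pow_pred_clog_lt_self one_lt_two h1
      have h3 : ((Nat.clog 2 N).pred : ℝ) ≤ Real.logb 2 N := by
        rw [Real.le_logb_iff_rpow_le one_lt_two (by exact_mod_cast hN0), Real.rpow_natCast]
        exact_mod_cast h2.le
      have h4 := Nat.succ_pred_eq_of_pos (Nat.clog_pos one_lt_two h1)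
      rw [← h4]
      push_cast
      linarith
  refine ⟨fixedLength n hn hle, ?_⟩
  have hn' : (0 : ℝ) < n := by exact_mod_cast hn
  simp only [meanAge, len_fixedLength, integral_const, probReal_univ, one_smul]
  rw [show (n : ℝ) + (n : ℝ) ^ 2 / (2 * n) - 1 / 2 = 3 / 2 * n - 1 / 2 by field_simp; ring]
  linarith

variable [DiscreteMeasurableSpace 𝒳]

/-- The noiseless source coding converse. -/
lemma entropyBits_le_integral_len (e : PrefixFreeCode 𝒳) (P : PMF 𝒳) :
    entropyBits P ≤ ∫ x, (e.len x : ℝ) ∂P.toMeasure := by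
  rw [PMF.integral_eq_sum, entropyBits, neg_le_iff_add_nonneg, ← Finset.sum_add_distrib]
  have hlog : 0 < Real.log 2 := Real.log_pos one_lt_two
  -- This is `log z ≤ z - 1` at `z = 2^(-ℓ(x)) / P(x)`; where `P(x) = 0` the left side is negative
  -- and the right side vanishes.
  have hterm : ∀ x, ((P x).toReal - (1 / 2 : ℝ) ^ e.len x) / Real.log 2 ≤
      (P x).toReal • (e.len x : ℝ) + (P x).toReal * Real.logb 2 (P x).toReal := by
    intro x
    rw [div_le_iff₀ hlog, smul_eq_mul, ← mul_add, mul_assoc, add_mul, Real.logb,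
      div_mul_cancel₀ _ hlog.ne']
    rcases (ENNReal.toReal_nonneg (a := P x)).eq_or_lt with h0 | hp
    · rw [← h0]; simp
    · have hq : (0 : ℝ) < (1 / 2 : ℝ) ^ e.len x := by positivity
      have h := Real.log_le_sub_one_of_pos (div_pos hq hp)
      rw [Real.log_div hq.ne' hp.ne', Real.log_pow, one_div, Real.log_inv] at h
      have h' := mul_le_mul_of_nonneg_left h hp.le
      rw [mul_sub, mul_sub, mul_div_cancel₀ _ hp.ne'] at h'
      rw [one_div]
      linarith
  refine le_trans ?_ (Finset.sum_le_sum fun x _ => hterm x)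
  rw [← Finset.sum_div, Finset.sum_sub_distrib, PMF.sum_toReal_eq_one]
  exact div_nonneg (sub_nonneg.2 e.sum_two_pow_neg_len_le_one) hlog.le

lemma three_halves_mul_integral_len_le_meanAge (e : PrefixFreeCode 𝒳) (P : PMF 𝒳) :
    3 / 2 * (∫ x, (e.len x : ℝ) ∂P.toMeasure) - 1 / 2 ≤ e.meanAge P := by
  have hm := e.one_le_integral_len P
  have hq : (∫ x, (e.len x : ℝ) ∂P.toMeasure) ^ 2 ≤ ∫ x, (e.len x : ℝ) ^ 2 ∂P.toMeasure := by
    set m := ∫ x, (e.len x : ℝ) ∂P.toMeasure with hmdef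
    have h := integral_nonneg (μ := P.toMeasure) (f := fun x => ((e.len x : ℝ) - m) ^ 2) fun x => sq_nonneg ((e.len x : ℝ) - m)
    simp only [sub_sq] at h
    rw [integral_add .of_finite .of_finite, integral_sub .of_finite .of_finite,
      integral_mul_const, integral_const_mul, ← hmdef] at h
    simp at h
    nlinarith
  rw [meanAge]
  have : (∫ x, (e.len x : ℝ) ∂P.toMeasure) / 2 ≤ (∫ x, (e.len x : ℝ) ^ 2 ∂P.toMeasure) /
      (2 * ∫ x, (e.len x : ℝ) ∂P.toMeasure) := by
    rw [le_div_iff₀ (by linarith)]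
    linarith
  linarith

/-! ### Existence of a minimizing code. -/

/-- Codes of bounded mean age have bounded mean length on the support, so only finitely many
values of the mean age lie below a given bound. -/
lemma finite_meanAge_le (P : PMF 𝒳) (C : ℝ) :
    {a | ∃ e : PrefixFreeCode 𝒳, e.meanAge P = a ∧ a ≤ C}.Finite := by
  classical
  -- The bound comes from `P(x) ℓ(x) ≤ E L ≤ C + 1`.
  obtain ⟨N, hN⟩ : ∃ N : ℕ, ∀ x ∈ P.support, (C + 1) / (P x).toReal ≤ N := by
    obtain ⟨N, hN⟩ := exists_nat_ge (∑ x, |(C + 1) / (P x).toReal|)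
    exact ⟨N, fun x _ => (le_abs_self _).trans ((Finset.single_le_sum
      (f := fun x => |(C + 1) / (P x).toReal|) (fun y _ => abs_nonneg _)
      (Finset.mem_univ x)).trans hN)⟩
  let g : (𝒳 → Fin (N + 1)) → ℝ := fun l => (∑ x, (P x).toReal * (l x : ℕ)) +
    (∑ x, (P x).toReal * ((l x : ℕ) : ℝ) ^ 2) / (2 * ∑ x, (P x).toReal * (l x : ℕ)) - 1 / 2
  refine (Set.finite_range g).subset ?_
  rintro _ ⟨e, rfl, hC⟩
  have hm := e.one_le_integral_len P
  have hle : ∫ x, (e.len x : ℝ) ∂P.toMeasure ≤ C + 1 := by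
    linarith [e.three_halves_mul_integral_len_le_meanAge P]
  have hlen : ∀ x ∈ P.support, e.len x ≤ N := by
    intro x hx
    have hp : 0 < (P x).toReal := ENNReal.toReal_pos ((P.mem_support_iff x).1 hx)
      (P.apply_ne_top x)
    rw [PMF.integral_eq_sum] at hle
    have h1 := (Finset.single_le_sum (f := fun x => (P x).toReal • (e.len x : ℝ))
      (fun y _ => by positivity) (Finset.mem_univ x)).trans hle
    rw [smul_eq_mul, ← le_div_iff₀' hp] at h1
    exact_mod_cast h1.trans (hN x hx)
  -- Codewords of null symbols may be arbitrarily long; truncating their lengths at `N` leaves the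
  -- mean age unchanged.
  refine ⟨fun x => ⟨min (e.len x) N, Nat.lt_succ_of_le (min_le_right _ _)⟩, ?_⟩
  have hcongr : ∀ f : ℕ → ℝ,
      ∑ x, (P x).toReal * f (min (e.len x) N) = ∑ x, (P x).toReal • f (e.len x) := by
    refine fun f => Finset.sum_congr rfl fun x _ => ?_
    by_cases hx : x ∈ P.support
    · rw [min_eq_left (hlen x hx), smul_eq_mul]
    · rw [(P.apply_eq_zero_iff x).2 hx]; simp
  simp only [g, meanAge, PMF.integral_eq_sum]
  rw [hcongr fun n => (n : ℝ), hcongr fun n => (n : ℝ) ^ 2]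

lemma exists_forall_meanAge_le [Nonempty (PrefixFreeCode 𝒳)] (P : PMF 𝒳) :
    ∃ e : PrefixFreeCode 𝒳, ∀ e' : PrefixFreeCode 𝒳, e.meanAge P ≤ e'.meanAge P := by
  let e₀ : PrefixFreeCode 𝒳 := Classical.arbitrary _
  obtain ⟨a, ⟨e, rfl, ha⟩, hmin⟩ := Set.exists_min_image _ id
    (finite_meanAge_le P (e₀.meanAge P)) ⟨_, e₀, rfl, le_rfl⟩
  refine ⟨e, fun e' => ?_⟩
  by_cases h : e'.meanAge P ≤ e₀.meanAge P
  · exact hmin _ ⟨e', rfl, h⟩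
  · exact ha.trans (le_of_not_ge h)

end PrefixFreeCode

theorem mainTheorem5 {𝒳 : Type*} [Fintype 𝒳] [MeasurableSpace 𝒳] [DiscreteMeasurableSpace 𝒳]
    (P : PMF 𝒳)
    {Ω : Type*} [MeasurableSpace Ω] (μ : Measure Ω) [IsProbabilityMeasure μ]
    (X : ℕ → Ω → 𝒳)
    (hlaw : ∀ t, 1 ≤ t → HasLaw (X t) P.toMeasure μ)
    (hindep : iIndepFun (fun t : ℕ => X (t + 1)) μ) :
    -- the average age of every prefix-free code is almost surely a finite constant
    (∀ e : PrefixFreeCode 𝒳, ∃ a : ℝ,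
      ∀ᵐ ω ∂μ, e.averageAge (fun t => X t ω) = (a : EReal)) ∧
    -- and the minimum of these constants over all prefix-free codes satisfies the bounds
    ∃ Amin : ℝ,
      IsLeast {a : ℝ | ∃ e : PrefixFreeCode 𝒳,
        ∀ᵐ ω ∂μ, e.averageAge (fun t => X t ω) = (a : EReal)} Amin ∧
      3 / 2 * entropyBits P - 1 / 2 ≤ Amin ∧
      Amin ≤ 3 / 2 * Real.logb 2 (Fintype.card 𝒳) + 1 := by
  have hae := fun e : PrefixFreeCode 𝒳 => e.ae_averageAge_eq hlaw hindep
  refine ⟨fun e => ⟨_, hae e⟩, ?_⟩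
  obtain ⟨e₁, he₁⟩ := PrefixFreeCode.exists_meanAge_le P
  have : Nonempty (PrefixFreeCode 𝒳) := ⟨e₁⟩
  obtain ⟨e, he⟩ := PrefixFreeCode.exists_forall_meanAge_le P
  refine ⟨e.meanAge P, ⟨⟨e, hae e⟩, ?_⟩, ?_, (he e₁).trans he₁⟩
  · rintro a ⟨e', he'⟩
    -- Two almost sure constants agree since both hold at some common `ω`.
    obtain ⟨ω, h₁, h₂⟩ := ((hae e').and he').exists
    rw [← EReal.coe_eq_coe_iff.1 (h₁.symm.trans h₂)]
    exact he e'
  · linarith [e.three_halves_mul_integral_len_le_meanAge P, e.entropyBits_le_integral_len P]
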